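/- Let $\hbar, M, L>0$, $\nu\ge 0$, $\beta\ge 0$, $\varepsilon_0=\hbar^2\pi^2/(2ML^2)$, and for $n\in\mathbb N=\{0,1,2,\dots\}$ put $$E_n=\varepsilon_0\Big((n+\nu+1)^2-\frac{\beta^2}{(n+\nu+1)^2}\Big),\qquad \phi_n(x)=K_n\,\sin^{\nu+n+1}\!\Big(\frac{\pi x}{L}\Big)\exp\!\Big(-\frac{\beta\pi x}{L(\nu+n+1)}\Big)P_n^{(a_n,\bar a_n)}\!\Big(i\cot\frac{\pi x}{L}\Big),$$ the eigenvalues and normalized eigenfunctions of the Pöschl–Teller Hamiltonian $-\frac{\hbar^2}{2M}\frac{d^2}{dx^2}+\varepsilon_0\big(\frac{\nu(\nu+1)}{\sin^2(\pi x/L)}-2\beta\cot\frac{\pi x}{L}\big)$ on $[0,L]$; here $a_n=-(n+\nu+1)+\frac{i\beta}{n+\nu+1}$, $P_n^{(a,b)}$ is the Jacobi polynomial and $K_n>0$ is the constant for which $\phi_n$ has norm $1$ in $L^2([0,L])$. Define recursively, starting from $\phi_n^{(0)}=\phi_n$, for $m\ge 0$, $$W_m=-\hbar\,\frac{(\phi_0^{(m)})'}{\phi_0^{(m)}},\quad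 A_m=\hbar\frac{d}{dx}+W_m,\quad A_m^\dagger=-\hbar\frac{d}{dx}+W_m,\quad B_m=A_m\cdots A_1A_0,\quad B_m^\dagger=A_0^\dagger A_1^\dagger\cdots A_m^\dagger,$$ $$\phi_n^{(m+1)}=\frac{B_m\,\phi_{n+m+1}}{\sqrt{(2M)^{m+1}\prod_{k=0}^m (E_{n+m+1}-E_k)}} .$$ For integers $m\ge 0$ and $n\ge -m-1$ let $\mathcal M(n,m)\ge 0$ be given by $$\mathcal M(n,m)^2=\prod_{k=0}^m (n+m-k+1)(n+m+2\nu+k+3)\Big(1+\frac{\beta^2}{[(k+\nu+1)(n+m+\nu+2)]^2}\Big),$$ and write $\langle T\rangle_f=\int_0^L\overline{f(x)}\,(Tf)(x)\,dx$. Then for all $m,n\in\mathbb N$ the functions $\phi_0^{(k)}$, $0\le k\le m$, have no zero in $(0,L)$ and the functions $\phi_j^{(k)}$, $0\le k\le m+1$, $j\ge 0$, are smooth on $(0,L)$ (so that the operators above act on them classically); the functions $\phi_n^{(m+1)}$, $B_mB_m^\dagger\phi_n^{(m+1)}$, $\phi_n$ and $B_m^\dagger B_m\phi_n$ lie in $L^2([0,L])$;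 and $$\langle B_mB_m^\dagger\rangle_{\phi_n^{(m+1)}}=\Big[\Big(\frac{\pi\hbar}{L}\Big)^{m+1}\mathcal M(n,m)\Big]^2,\qquad \langle B_m^\dagger B_m\rangle_{\phi_n}=\Big[\Big(\frac{\pi\hbar}{L}\Big)^{m+1}\mathcal M(n-m-1,m)\Big]^2 .$$ -/

import Mathlib

open MeasureTheory
open scoped ContDiff

/-- The physical and shape parameters of the Pöschl-Teller model on `[0, L]`. -/
structure PTParams where
  /-- the reduced Planck constant `ħ` -/
  hbar : ℝ
  /-- the particle mass `M` -/
  mass : ℝ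
  /-- the width `L` of the interval -/
  L : ℝ
  /-- the parameter `ν` -/
  nu : ℝ
  /-- the parameter `β` -/
  beta : ℝ

/-- The Jacobi polynomial `P_n^{(a,b)}(z)` with arbitrary complex parameters:
`(1/n!) ∑_k C(n,k) (n+a+b+1)_k (a+k+1)_{n-k} ((z-1)/2)^k`, where `(c)_k` is the rising factorial. -/
noncomputable def jacobiP (n : ℕ) (a b z : ℂ) : ℂ :=
  (∑ k ∈ Finset.range (n + 1),
    (n.choose k : ℂ) * (ascPochhammer ℂ k).eval ((n : ℂ) + a + b + 1) *
      (ascPochhammer ℂ (n - k)).eval (a + (k : ℂ) + 1) * ((z - 1) / 2) ^ k) / (n.factorial : ℂ)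

namespace PTParams

/-- The energy scale `ε₀ = ħ²π² / (2ML²)`. -/
noncomputable def eps0 (p : PTParams) : ℝ :=
  p.hbar ^ 2 * Real.pi ^ 2 / (2 * p.mass * p.L ^ 2)

/-- The eigenvalue `E_n = ε₀ ((n+ν+1)² - β²/(n+ν+1)²)`. -/
noncomputable def energy (p : PTParams) (n : ℕ) : ℝ :=
  p.eps0 * (((n : ℝ) + p.nu + 1) ^ 2 - p.beta ^ 2 / ((n : ℝ) + p.nu + 1) ^ 2)

/-- The Jacobi parameter `a_n = -(n+ν+1) + iβ/(n+ν+1)`. -/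
noncomputable def jacobiParam (p : PTParams) (n : ℕ) : ℂ :=
  ⟨-((n : ℝ) + p.nu + 1), p.beta / ((n : ℝ) + p.nu + 1)⟩

/-- The eigenfunction before normalization:
`sin^{ν+n+1}(πx/L) exp(-βπx/(L(ν+n+1))) P_n^{(a_n, ā_n)}(i cot(πx/L))`. -/
noncomputable def rawEigenfunction (p : PTParams) (n : ℕ) (x : ℝ) : ℂ :=
  ((Real.sin (Real.pi * x / p.L) ^ (p.nu + (n : ℝ) + 1) *
      Real.exp (-(p.beta * Real.pi * x / (p.L * (p.nu + (n : ℝ) + 1)))) : ℝ) : ℂ) *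
    jacobiP n (p.jacobiParam n) (star (p.jacobiParam n))
      (Complex.I * ((Real.cot (Real.pi * x / p.L) : ℝ) : ℂ))

/-- The normalization constant `K_n > 0`, the inverse of the norm in `L²([0, L])`. -/
noncomputable def normConst (p : PTParams) (n : ℕ) : ℝ :=
  (Real.sqrt (∫ x in (0 : ℝ)..p.L, ‖p.rawEigenfunction n x‖ ^ 2))⁻¹

/-- The normalized eigenfunction `φ_n` of the Pöschl-Teller Hamiltonian. -/
noncomputable def phi (p : PTParams) (n : ℕ) (x : ℝ) : ℂ :=
  (p.normConst n : ℂ) * p.rawEigenfunction n x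

/-- The first order differential operator `ħ d/dx + W`. -/
noncomputable def lowerWith (p : PTParams) (W f : ℝ → ℂ) (x : ℝ) : ℂ :=
  (p.hbar : ℂ) * deriv f x + W x * f x

/-- The first order differential operator `-ħ d/dx + W`. -/
noncomputable def raiseWith (p : PTParams) (W f : ℝ → ℂ) (x : ℝ) : ℂ :=
  -(p.hbar : ℂ) * deriv f x + W x * f x

/-- The superpotential `-ħ g'/g` of a ground state `g`. -/
noncomputable def superpotentialOf (p : PTParams) (g : ℝ → ℂ) (x : ℝ) : ℂ :=
  -(p.hbar : ℂ) * deriv g x / g x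

/-- Given `T = A_{m-1} ⋯ A_1 A_0`, the function
`φ_n^{(m)} = T φ_{n+m} / √((2M)^m ∏_{k<m} (E_{n+m} - E_k))`. -/
noncomputable def hierState (p : PTParams) (T : (ℝ → ℂ) → ℝ → ℂ) (m n : ℕ) (x : ℝ) : ℂ :=
  T (p.phi (n + m)) x /
    ((Real.sqrt ((2 * p.mass) ^ m *
      ∏ k ∈ Finset.range m, (p.energy (n + m) - p.energy k)) : ℝ) : ℂ)

/-- The product `A_{m-1} ⋯ A_1 A_0` (the identity for `m = 0`), where
`A_k = ħ d/dx + W_k` and `W_k = -ħ (φ_0^{(k)})' / φ_0^{(k)}`. -/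
noncomputable def lowerProd (p : PTParams) : ℕ → (ℝ → ℂ) → ℝ → ℂ
  | 0 => fun f => f
  | m + 1 => fun f =>
      p.lowerWith (p.superpotentialOf (p.hierState (p.lowerProd m) m 0)) (p.lowerProd m f)

/-- The eigenfunction `φ_n^{(m)}` of the `m`-th Hamiltonian of the hierarchy; `φ_n^{(0)} = φ_n`. -/
noncomputable def eigenfunction (p : PTParams) (m n : ℕ) : ℝ → ℂ :=
  p.hierState (p.lowerProd m) m n

/-- The superpotential `W_m = -ħ (φ_0^{(m)})' / φ_0^{(m)}`. -/
noncomputable def superpotential (p : PTParams) (m : ℕ) : ℝ → ℂ :=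
  p.superpotentialOf (p.eigenfunction m 0)

/-- The operator `A_m = ħ d/dx + W_m`; `A_0` is the operator without index. -/
noncomputable def opA (p : PTParams) (m : ℕ) (f : ℝ → ℂ) : ℝ → ℂ :=
  p.lowerWith (p.superpotential m) f

/-- The operator `A_m† = -ħ d/dx + W_m`. -/
noncomputable def opAdag (p : PTParams) (m : ℕ) (f : ℝ → ℂ) : ℝ → ℂ :=
  p.raiseWith (p.superpotential m) f

/-- The operator `B_m = A_m ⋯ A_1 A_0`. -/
noncomputable def opB (p : PTParams) : ℕ → (ℝ → ℂ) → ℝ → ℂ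
  | 0 => fun f => p.opA 0 f
  | m + 1 => fun f => p.opA (m + 1) (p.opB m f)

/-- The operator `B_m† = A_0† A_1† ⋯ A_m†`. -/
noncomputable def opBdag (p : PTParams) : ℕ → (ℝ → ℂ) → ℝ → ℂ
  | 0 => fun f => p.opAdag 0 f
  | m + 1 => fun f => p.opBdag m (p.opAdag (m + 1) f)

/-- The quantity `𝓜(n,m)`, the nonnegative square root of
`∏_{k=0}^m (n+m-k+1)(n+m+2ν+k+3)(1 + β²/[(k+ν+1)(n+m+ν+2)]²)`; here `n` is an integer `≥ -m-1`. -/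
noncomputable def calM (p : PTParams) (n : ℤ) (m : ℕ) : ℝ :=
  Real.sqrt (∏ k ∈ Finset.range (m + 1),
    (((n : ℝ) + m - k + 1) * ((n : ℝ) + m + 2 * p.nu + k + 3) *
      (1 + p.beta ^ 2 / (((k : ℝ) + p.nu + 1) * ((n : ℝ) + m + p.nu + 2)) ^ 2)))

/-- The mean value `⟨T⟩_f = ∫_0^L conj(f) T f dx`. -/
noncomputable def meanValue (p : PTParams) (T : (ℝ → ℂ) → ℝ → ℂ) (f : ℝ → ℂ) : ℂ :=
  ∫ x in (0 : ℝ)..p.L, star (f x) * T f x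

/-- Membership in the Hilbert space `L²([0, L])`. -/
def InL2 (p : PTParams) (f : ℝ → ℂ) : Prop :=
  MemLp f 2 (volume.restrict (Set.Icc 0 p.L))

/-- `A_m ⋯ A_0` built in the recursion is the product of the operators `A_k`. -/
theorem lowerProd_succ (p : PTParams) (m : ℕ) (f : ℝ → ℂ) :
    p.lowerProd (m + 1) f = p.opA m (p.lowerProd m f) := rfl

/-- Hence `φ_n^{(m+1)}` is `B_m φ_{n+m+1}` divided by the stated square root. -/
theorem lowerProd_succ_eq_opB (p : PTParams) (m : ℕ) (f : ℝ → ℂ) :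
    p.lowerProd (m + 1) f = p.opB m f := by
  induction m with
  | zero => rfl
  | succ m ih => rw [lowerProd_succ, ih]; rfl

/-- The zeroth level of the hierarchy is the original one. -/
theorem eigenfunction_zero (p : PTParams) (n : ℕ) : p.eigenfunction 0 n = p.phi n := by
  funext x
  simp [eigenfunction, hierState, lowerProd]

end PTParams

/-
Every function of the hierarchy descending from `φ_N` is the fixed factor
`sin^s θ exp (-βθ/s)`, with `θ = πx/L` and `s = N + ν + 1`, times a polynomial in `cot θ`. On these
polynomials `A_k` and `A_k†` act as first-order operators with coefficients affine in `cot θ`, as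
soon as the superpotential `W_k` is the expected affine function of `cot θ`. Shape invariance,
`A_k A_k† = A_{k+1}† A_{k+1} + const`, then shows by induction that `A_k† A_k` acts on
`A_{k-1} ⋯ A_0 φ_N` as multiplication by `g_k = 2M (E_N - E_k)`; the base case is the Jacobi
differential equation. This eigenvalue equation forces each `A_k` to lower the degree of the
polynomial by one, so `φ_0^{(k)}` has a constant polynomial. Hence it has no zeros and its
superpotential is the expected one. Integration by parts makes the `φ_n^{(k)}` normalized, and both
mean values equal `g_0 g_1 ⋯ g_m`.
-/

section FactorizationChain

variable {R V : Type*} [CommRing R] [AddCommGroup V] [Module R V]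

/-- The product `A_{k-1} ⋯ A_1 A_0` of the lowering operators of a hierarchy. -/
def lowerChain (A : ℕ → Module.End R V) : ℕ → Module.End R V
  | 0 => 1
  | k + 1 => A k * lowerChain A k

/-- The product `A_0† A_1† ⋯ A_{k-1}†` of the raising operators of a hierarchy. -/
def raiseChain (Ad : ℕ → Module.End R V) : ℕ → Module.End R V
  | 0 => 1
  | k + 1 => raiseChain Ad k * Ad k

theorem lowerChain_succ_apply (A : ℕ → Module.End R V) (k : ℕ) (v : V) :
    lowerChain A (k + 1) v = A k (lowerChain A k v) := rfl

theorem raiseChain_succ_apply (Ad : ℕ → Module.End R V) (k : ℕ) (v : V) :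
    raiseChain Ad (k + 1) v = raiseChain Ad k (Ad k v) := rfl

/-- A hierarchy of factorized operators `A_k† A_k`, in which `A_k A_k†` and `A_{k+1}† A_{k+1}`
differ by the constant `g k - g (k + 1)`, together with a vector `v` on which `A_0† A_0` acts as
multiplication by `g 0`. The operators `A_k†` are arbitrary: no adjointness is built in. -/
structure FactorizationChain (A Ad : ℕ → Module.End R V) (g : ℕ → R) (v : V) : Prop where
  ground : Ad 0 (A 0 v) = g 0 • v
  intertwine : ∀ k w, A k (Ad k w) = Ad (k + 1) (A (k + 1) w) + (g k - g (k + 1)) • w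

namespace FactorizationChain

variable {A Ad : ℕ → Module.End R V} {g : ℕ → R} {v : V}

theorem raise_lower_lowerChain (h : FactorizationChain A Ad g v) (k : ℕ) :
    Ad k (A k (lowerChain A k v)) = g k • lowerChain A k v := by
  induction k with
  | zero => exact h.ground
  | succ k ih =>
    have hk := h.intertwine k (A k (lowerChain A k v))
    rw [ih, map_smul, ← lowerChain_succ_apply, sub_smul] at hk
    exact (add_right_cancel ((add_sub_cancel _ _).trans hk)).symm

theorem raiseChain_lowerChain (h : FactorizationChain A Ad g v) (k : ℕ) :
    raiseChain Ad k (lowerChain A k v) = (∏ j ∈ Finset.range k, g j) • v := by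
  induction k with
  | zero => simp [raiseChain, lowerChain]
  | succ k ih =>
    rw [raiseChain_succ_apply, lowerChain_succ_apply, h.raise_lower_lowerChain, map_smul, ih,
      smul_smul, Finset.prod_range_succ, mul_comm]

theorem lowerChain_ne_zero [IsDomain R] [Module.IsTorsionFree R V] (h : FactorizationChain A Ad g v)
    (hv : v ≠ 0) {k : ℕ} (hg : ∀ j < k, g j ≠ 0) : lowerChain A k v ≠ 0 := by
  intro h0
  have hprod : ∏ j ∈ Finset.range k, g j ≠ 0 :=
    Finset.prod_ne_zero_iff.mpr fun j hj => hg j (Finset.mem_range.mp hj)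
  refine smul_ne_zero hprod hv ?_
  rw [← h.raiseChain_lowerChain, h0, map_zero]

end FactorizationChain

end FactorizationChain

section Jacobi

open Polynomial

theorem mem_degreeLT_iff_coeff {R : Type*} [Semiring R] {n : ℕ} {q : R[X]} :
    q ∈ degreeLT R n ↔ ∀ i, n ≤ i → q.coeff i = 0 :=
  mem_degreeLT.trans (degree_lt_iff_coeff_zero q n)

/-- The Jacobi polynomial `P_n^{(a,b)}` as a polynomial in the variable `(z - 1) / 2`, in which the
coefficients of `jacobiP` are given. -/
noncomputable def jacobiPoly (n : ℕ) (a b : ℂ) : ℂ[X] :=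
  ∑ k ∈ Finset.range (n + 1), monomial k
    ((n.choose k : ℂ) * (ascPochhammer ℂ k).eval ((n : ℂ) + a + b + 1) *
      (ascPochhammer ℂ (n - k)).eval (a + (k : ℂ) + 1) / (n.factorial : ℂ))

variable (n : ℕ) (a b : ℂ)

theorem eval_jacobiPoly (z : ℂ) : (jacobiPoly n a b).eval ((z - 1) / 2) = jacobiP n a b z := by
  simp only [jacobiP, jacobiPoly, eval_finsetSum, eval_monomial, Finset.sum_div]
  exact Finset.sum_congr rfl fun k _ => by ring

theorem coeff_jacobiPoly (k : ℕ) :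
    (jacobiPoly n a b).coeff k =
      (n.choose k : ℂ) * (ascPochhammer ℂ k).eval ((n : ℂ) + a + b + 1) *
      (ascPochhammer ℂ (n - k)).eval (a + (k : ℂ) + 1) / (n.factorial : ℂ) := by
  simp only [jacobiPoly, finsetSum_coeff, coeff_monomial, Finset.sum_ite_eq', Finset.mem_range]
  split_ifs with hk
  · rfl
  · rw [Nat.choose_eq_zero_of_lt (by omega)]
    simp

theorem natDegree_jacobiPoly_le : (jacobiPoly n a b).natDegree ≤ n := by
  refine natDegree_le_iff_coeff_eq_zero.mpr fun k hk => ?_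
  rw [coeff_jacobiPoly, Nat.choose_eq_zero_of_lt hk]
  simp

theorem coeff_jacobiPoly_succ (k : ℕ) :
    ((k : ℂ) + 1) * (a + k + 1) * (jacobiPoly n a b).coeff (k + 1) =
      ((n : ℂ) - k) * (n + a + b + 1 + k) * (jacobiPoly n a b).coeff k := by
  rcases lt_or_ge k n with hk | hk
  · have hchoose : (n.choose (k + 1) : ℂ) * (k + 1) = n.choose k * (n - k) := by
      rw [← Nat.cast_sub hk.le]
      exact_mod_cast Nat.choose_succ_right_eq n k
    have hpoch : (ascPochhammer ℂ (n - k)).eval (a + k + 1) =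
        (a + k + 1) * (ascPochhammer ℂ (n - (k + 1))).eval (a + (k + 1 : ℕ) + 1) := by
      rw [show n - k = n - (k + 1) + 1 by omega, ascPochhammer_succ_left, eval_mul, eval_comp,
        eval_X, eval_add, eval_X, eval_one, Nat.cast_succ, add_assoc a]
    rw [coeff_jacobiPoly, coeff_jacobiPoly, hpoch, ascPochhammer_succ_eval]
    linear_combination (a + k + 1) * ((ascPochhammer ℂ k).eval (n + a + b + 1) *
      (n + a + b + 1 + k)) * (ascPochhammer ℂ (n - (k + 1))).eval (a + (k + 1 : ℕ) + 1) /
      (n.factorial : ℂ) * hchoose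
  · rw [coeff_eq_zero_of_natDegree_lt ((natDegree_jacobiPoly_le n a b).trans_lt (by omega))]
    rcases hk.eq_or_lt with rfl | hk
    · simp
    · rw [coeff_eq_zero_of_natDegree_lt ((natDegree_jacobiPoly_le n a b).trans_lt hk)]
      simp

theorem jacobiPoly_ode :
    X * (1 + X) * derivative (derivative (jacobiPoly n a b)) +
      (C (a + 1) + C (a + b + 2) * X) * derivative (jacobiPoly n a b) =
      C (n * (n + a + b + 1)) * jacobiPoly n a b := by
  have hrec := coeff_jacobiPoly_succ n a b
  generalize jacobiPoly n a b = J at hrec ⊢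
  have expand : X * (1 + X) * derivative (derivative J) +
      (C (a + 1) + C (a + b + 2) * X) * derivative J =
      X * derivative (derivative J) + X * (X * derivative (derivative J)) +
      C (a + 1) * derivative J + C (a + b + 2) * (X * derivative J) := by ring
  rw [expand]
  ext k
  specialize hrec k
  rcases k with _ | _ | k <;>
    simp only [coeff_add, coeff_C_mul, coeff_X_mul, coeff_X_mul_zero, coeff_derivative,
      Nat.cast_add, Nat.cast_one, Nat.cast_zero, zero_add, Nat.reduceAdd] at hrec ⊢ <;>
    linear_combination hrec

theorem jacobiPoly_ne_zero (h : ∀ k < n, (k : ℂ) ≠ -(n + a + b + 1)) : jacobiPoly n a b ≠ 0 := by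
  intro h0
  have hlead := coeff_jacobiPoly n a b n
  rw [h0, coeff_zero, Nat.choose_self, Nat.sub_self, ascPochhammer_zero, eval_one, Nat.cast_one,
    one_mul, mul_one, eq_comm, div_eq_zero_iff, ascPochhammer_eval_eq_zero_iff] at hlead
  rcases hlead with ⟨k, hk, hroot⟩ | hfact
  · exact h k hk hroot
  · exact n.factorial_ne_zero (by exact_mod_cast hfact)

end Jacobi

namespace PTParams

open Polynomial

variable {p : PTParams}

section Parameters

/-- The shape parameter `k + ν + 1` of the `k`-th Hamiltonian of the hierarchy. -/
noncomputable def level (p : PTParams) (k : ℕ) : ℝ := k + p.nu + 1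

/-- The factor `πħ/L` produced by `ħ d/dx` acting on functions of `πx/L`. -/
noncomputable def scale (p : PTParams) : ℝ := Real.pi * p.hbar / p.L

/-- The eigenvalue of `A_k† A_k` on the descendants of `φ_N`, for `s = N + ν + 1` and
`r = k + ν + 1`. -/
noncomputable def gap (p : PTParams) (s r : ℝ) : ℝ :=
  p.scale ^ 2 * (s ^ 2 - r ^ 2) * (1 + p.beta ^ 2 / (r * s) ^ 2)

theorem level_pos (hnu : -1 < p.nu) (k : ℕ) : 0 < p.level k := by
  unfold level
  linarith [k.cast_nonneg (α := ℝ)]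

theorem level_add (j k : ℕ) : p.level (j + k) = p.level k + j := by
  simp only [level, Nat.cast_add]
  ring

theorem scale_ne_zero (hhbar : p.hbar ≠ 0) (hL : p.L ≠ 0) : p.scale ≠ 0 :=
  div_ne_zero (mul_ne_zero Real.pi_ne_zero hhbar) hL

theorem gap_self (s : ℝ) : p.gap s s = 0 := by simp [gap]

theorem gap_neg (s r : ℝ) : p.gap s (-r) = p.gap s r := by
  simp only [gap, neg_mul, even_two.neg_pow]

theorem gap_pos (hscale : p.scale ≠ 0) {s r : ℝ} (hr : 0 ≤ r) (hrs : r < s) : 0 < p.gap s r := by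
  have hsq : 0 < s ^ 2 - r ^ 2 := sub_pos.mpr (pow_lt_pow_left₀ hrs hr two_ne_zero)
  unfold gap
  positivity

theorem gap_level_pos (hnu : -1 < p.nu) (hscale : p.scale ≠ 0) {N k : ℕ} (hk : k < N) :
    0 < p.gap (p.level N) (p.level k) := by
  refine gap_pos hscale (level_pos hnu k).le ?_
  have hcast : (k : ℝ) < N := mod_cast hk
  unfold level
  linarith

theorem prod_gap_pos (hnu : -1 < p.nu) (hscale : p.scale ≠ 0) {N k : ℕ} (hk : k ≤ N) :
    0 < ∏ i ∈ Finset.range k, p.gap (p.level N) (p.level i) :=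
  Finset.prod_pos fun _ hi => gap_level_pos hnu hscale ((Finset.mem_range.mp hi).trans_le hk)

theorem prod_gap_nonneg (hnu : -1 < p.nu) (hscale : p.scale ≠ 0) (N k : ℕ) :
    0 ≤ ∏ i ∈ Finset.range k, p.gap (p.level N) (p.level i) := by
  rcases lt_or_ge N k with hNk | hkN
  · rw [Finset.prod_eq_zero (Finset.mem_range.mpr hNk) (gap_self _)]
  · exact (prod_gap_pos hnu hscale hkN).le

theorem two_mass_mul_energy_sub (hmass : p.mass ≠ 0) (hL : p.L ≠ 0) (hnu : -1 < p.nu) (N k : ℕ) :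
    2 * p.mass * (p.energy N - p.energy k) = p.gap (p.level N) (p.level k) := by
  have hN : p.level N ≠ 0 := (level_pos hnu N).ne'
  have hk : p.level k ≠ 0 := (level_pos hnu k).ne'
  have henergy (n : ℕ) : p.energy n =
      p.eps0 * (p.level n ^ 2 - p.beta ^ 2 / p.level n ^ 2) := rfl
  rw [henergy, henergy, eps0, gap, scale]
  field_simp
  ring

end Parameters

section LadderPolynomials

/-- The polynomial in `cot (πx/L)` equal to the superpotential with shape parameter `r`. -/
noncomputable def superPoly (p : PTParams) (r : ℝ) : ℂ[X] :=
  C (p.scale : ℂ) * (C (p.beta / r : ℂ) - C (r : ℂ) * X)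

/-- The operator `d/dx` on the functions `wave p s q`, as an operator on the polynomial `q`. -/
noncomputable def derivPoly (p : PTParams) (s : ℝ) : Module.End ℂ ℂ[X] :=
  (Real.pi / p.L : ℂ) • (LinearMap.mulLeft ℂ (C (s : ℂ) * X - C (p.beta / s : ℂ)) -
    LinearMap.mulLeft ℂ (1 + X ^ 2) ∘ₗ derivative)

/-- The operator `ħ d/dx + W`, where `W` has shape parameter `r`, on the functions `wave p s q`. -/
noncomputable def lowerPoly (p : PTParams) (s r : ℝ) : Module.End ℂ ℂ[X] :=
  (p.hbar : ℂ) • p.derivPoly s + LinearMap.mulLeft ℂ (p.superPoly r)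

/-- The operator `-ħ d/dx + W`, where `W` has shape parameter `r`, on the functions `wave p s q`. -/
noncomputable def raisePoly (p : PTParams) (s r : ℝ) : Module.End ℂ ℂ[X] :=
  -((p.hbar : ℂ) • p.derivPoly s) + LinearMap.mulLeft ℂ (p.superPoly r)

/-- The hypergeometric operator of the Romanovski polynomials, to which the Pöschl-Teller
Hamiltonian reduces on the functions `wave p s q`. -/
noncomputable def romanovskiOp (p : PTParams) (s : ℝ) : Module.End ℂ ℂ[X] :=
  LinearMap.mulLeft ℂ (1 + X ^ 2) ∘ₗ derivative ∘ₗ derivative +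
    LinearMap.mulLeft ℂ (C (2 * (1 - s) : ℂ) * X + C (2 * (p.beta / s) : ℂ)) ∘ₗ derivative

theorem romanovskiOp_apply (s : ℝ) (q : ℂ[X]) :
    p.romanovskiOp s q = (1 + X ^ 2) * derivative (derivative q) +
      (C (2 * (1 - s) : ℂ) * X + C (2 * (p.beta / s) : ℂ)) * derivative q := rfl

theorem hbar_smul_derivPoly_C (s : ℝ) (c : ℂ) :
    (p.hbar : ℂ) • p.derivPoly s (C c) = -(p.superPoly s * C c) := by
  simp only [derivPoly, superPoly, scale, smul_eq_C_mul, LinearMap.smul_apply, LinearMap.sub_apply,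
    LinearMap.mulLeft_apply, LinearMap.comp_apply, derivative_C, Complex.ofReal_div,
    Complex.ofReal_mul, mul_div_right_comm _ (p.hbar : ℂ), C_mul]
  ring

theorem lowerPoly_apply (s r : ℝ) (q : ℂ[X]) :
    p.lowerPoly s r q = C (p.scale : ℂ) *
      ((C (s - r : ℂ) * X + C (p.beta / r - p.beta / s : ℂ)) * q - (1 + X ^ 2) * derivative q) := by
  simp only [lowerPoly, derivPoly, superPoly, scale, smul_eq_C_mul, LinearMap.smul_apply,
    LinearMap.add_apply, LinearMap.sub_apply, LinearMap.mulLeft_apply, LinearMap.comp_apply,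
    Complex.ofReal_div, Complex.ofReal_mul, mul_div_right_comm _ (p.hbar : ℂ), C_mul, C_sub]
  ring

/-- The reflection that turns shape invariance into the same identity as the factorization. -/
theorem lowerPoly_neg (s r : ℝ) : p.lowerPoly s (-r) = -p.raisePoly s r := by
  have hsuper : p.superPoly (-r) = -p.superPoly r := by
    simp only [superPoly, Complex.ofReal_neg, div_neg, C_neg]
    ring
  rw [lowerPoly, raisePoly, hsuper, neg_add, neg_neg]
  congr 1
  exact LinearMap.ext fun q => neg_mul _ q

theorem raisePoly_neg (s r : ℝ) : p.raisePoly s (-r) = -p.lowerPoly s r := by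
  rw [← neg_neg (p.raisePoly s (-r)), ← lowerPoly_neg, neg_neg]

theorem raisePoly_apply (s r : ℝ) (q : ℂ[X]) :
    p.raisePoly s r q = C (p.scale : ℂ) *
      ((1 + X ^ 2) * derivative q - (C (s + r : ℂ) * X - C (p.beta / r + p.beta / s : ℂ)) * q) := by
  rw [← neg_neg (p.raisePoly s r), ← lowerPoly_neg, LinearMap.neg_apply, lowerPoly_apply]
  simp only [Complex.ofReal_neg, div_neg, sub_neg_eq_add, C_add, C_sub, C_neg]
  ring

theorem raisePoly_lowerPoly {s r : ℝ} (hs : s ≠ 0) (hr : r ≠ 0) (q : ℂ[X]) :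
    p.raisePoly s r (p.lowerPoly s r q) = (p.gap s r : ℂ) • q -
      C (p.scale ^ 2 : ℂ) * (1 + X ^ 2) *
        (p.romanovskiOp s q - C ((s - r) * (1 - s - r) : ℂ) * q) := by
  have hs' : (s : ℂ) ≠ 0 := mod_cast hs
  have hr' : (r : ℂ) ≠ 0 := mod_cast hr
  have hgap : (p.gap s r : ℂ) = p.scale ^ 2 *
      (s ^ 2 - r ^ 2 + (p.beta / r : ℂ) ^ 2 - (p.beta / s : ℂ) ^ 2) := by
    simp only [gap]
    push_cast
    field_simp
    ring
  have hbeta : (s : ℂ) * (p.beta / s) = r * (p.beta / r) := by field_simp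
  rw [hgap]
  apply Polynomial.funext
  intro t
  simp only [raisePoly_apply, lowerPoly_apply, romanovskiOp_apply, derivative_add, derivative_sub,
    derivative_mul, derivative_C, derivative_X, derivative_X_pow, derivative_one, eval_smul,
    eval_add, eval_sub, eval_mul, eval_C, eval_X, eval_pow, eval_one, eval_zero, smul_eq_mul]
  push_cast
  linear_combination 2 * t * p.scale ^ 2 * q.eval t * hbeta

theorem lowerPoly_raisePoly {s r : ℝ} (hs : s ≠ 0) (hr : r ≠ 0) (hr' : r + 1 ≠ 0) (q : ℂ[X]) :
    p.lowerPoly s r (p.raisePoly s r q) =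
      p.raisePoly s (r + 1) (p.lowerPoly s (r + 1) q) +
        ((p.gap s r : ℂ) - p.gap s (r + 1)) • q := by
  have hfactor := raisePoly_lowerPoly (p := p) hs (neg_ne_zero.mpr hr) q
  rw [raisePoly_neg, lowerPoly_neg, LinearMap.neg_apply, LinearMap.neg_apply, map_neg, neg_neg,
    gap_neg] at hfactor
  rw [hfactor, raisePoly_lowerPoly hs hr', sub_smul]
  push_cast
  rw [show ((s : ℂ) - -r) * (1 - s - -r) = (s - (r + 1)) * (1 - s - (r + 1)) by ring]
  abel

theorem coeff_lowerPoly_succ (s r : ℝ) (q : ℂ[X]) (i : ℕ) :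
    (p.lowerPoly s r q).coeff (i + 1) = p.scale * ((s - r - i) * q.coeff i +
      (p.beta / r - p.beta / s) * q.coeff (i + 1) - (i + 2) * q.coeff (i + 2)) := by
  have hderiv : (X * derivative q).coeff i = i * q.coeff i := by
    cases i <;> simp [coeff_X_mul, coeff_derivative, mul_comm]
  have hexpand : p.lowerPoly s r q = C (p.scale : ℂ) * (C (s - r : ℂ) * (X * q) +
      C (p.beta / r - p.beta / s : ℂ) * q - derivative q - X * (X * derivative q)) := by
    rw [lowerPoly_apply]
    ring
  rw [hexpand, coeff_C_mul, coeff_sub, coeff_sub, coeff_add, coeff_C_mul, coeff_C_mul, coeff_X_mul,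
    coeff_X_mul, hderiv, coeff_derivative]
  push_cast
  ring

theorem coeff_raisePoly_succ (s r : ℝ) (q : ℂ[X]) (i : ℕ) :
    (p.raisePoly s r q).coeff (i + 1) = p.scale * (-(s + r - i) * q.coeff i +
      (p.beta / r + p.beta / s) * q.coeff (i + 1) + (i + 2) * q.coeff (i + 2)) := by
  rw [← neg_neg (p.raisePoly s r), ← lowerPoly_neg, LinearMap.neg_apply, coeff_neg,
    coeff_lowerPoly_succ, Complex.ofReal_neg, div_neg]
  ring

/-- Comparing top coefficients, `A` kills the leading term of `q`, and then the eigenvalue equation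
kills the next one. -/
theorem lowerPoly_mem_degreeLT (hscale : p.scale ≠ 0) {r : ℝ} (hr : r ≠ 0) {d : ℕ} {q : ℂ[X]}
    (hq : q ∈ degreeLT ℂ (d + 1)) {c : ℂ}
    (h : p.raisePoly (r + d) r (p.lowerPoly (r + d) r q) = c • q) :
    p.lowerPoly (r + d) r q ∈ degreeLT ℂ d := by
  have hq_coeff := mem_degreeLT_iff_coeff.mp hq
  have hhigh : ∀ i, d + 1 ≤ i → (p.lowerPoly (r + d) r q).coeff i = 0 := by
    intro i hi
    obtain ⟨i, rfl⟩ := Nat.exists_eq_add_of_le' (Nat.le_of_add_left_le hi)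
    rw [coeff_lowerPoly_succ, hq_coeff (i + 1) hi, hq_coeff (i + 2) (by omega)]
    rcases (Nat.le_of_add_le_add_right hi).eq_or_lt with rfl | hlt
    · push_cast
      ring
    · rw [hq_coeff i hlt]
      ring
  have htop : (p.lowerPoly (r + d) r q).coeff d = 0 := by
    have heigen := congrArg (coeff · (d + 1)) h
    simp only [coeff_raisePoly_succ, coeff_smul, hq_coeff (d + 1) le_rfl,
      hhigh (d + 1) le_rfl, hhigh (d + 2) (Nat.le_succ _), smul_zero, Complex.ofReal_add,
      Complex.ofReal_natCast] at heigen
    have hfactor : (-2 * p.scale * r : ℂ) * (p.lowerPoly (r + d) r q).coeff d = 0 := by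
      linear_combination heigen
    refine (mul_eq_zero.mp hfactor).resolve_left ?_
    simp [hscale, hr]
  refine mem_degreeLT_iff_coeff.mpr fun i hi => ?_
  rcases hi.eq_or_lt with rfl | hlt
  · exact htop
  · exact hhigh i hlt

/-- The polynomials `q` for which `wave p s q`, with `s = N + ν + 1`, is an eigenfunction of
`A_0† A_0` of degree at most `N`. -/
structure IsRomanovski (p : PTParams) (N : ℕ) (q : ℂ[X]) : Prop where
  mem : q ∈ degreeLT ℂ (N + 1)
  ode : p.romanovskiOp (p.level N) q =
    C ((p.level N - p.level 0) * (1 - p.level N - p.level 0) : ℂ) * q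

/-- The operators `A_0, A_1, …` acting on the polynomials of the descendants of `φ_N`. -/
noncomputable abbrev lowerSeq (p : PTParams) (N k : ℕ) : Module.End ℂ ℂ[X] :=
  p.lowerPoly (p.level N) (p.level k)

/-- The operators `A_0†, A_1†, …` acting on the polynomials of the descendants of `φ_N`. -/
noncomputable abbrev raiseSeq (p : PTParams) (N k : ℕ) : Module.End ℂ ℂ[X] :=
  p.raisePoly (p.level N) (p.level k)

namespace IsRomanovski

variable {N : ℕ} {q : ℂ[X]}

theorem const_smul (h : p.IsRomanovski N q) (c : ℂ) : p.IsRomanovski N (c • q) where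
  mem := Submodule.smul_mem _ c h.mem
  ode := by rw [map_smul, h.ode, mul_smul_comm]

theorem factorizationChain (h : p.IsRomanovski N q) (hnu : -1 < p.nu) :
    FactorizationChain (p.lowerSeq N) (p.raiseSeq N)
      (fun k => (p.gap (p.level N) (p.level k) : ℂ)) q where
  ground := by
    rw [raisePoly_lowerPoly (level_pos hnu N).ne' (level_pos hnu 0).ne', h.ode, sub_self, mul_zero,
      sub_zero]
  intertwine k w := by
    have hsucc : p.level (k + 1) = p.level k + 1 := by rw [add_comm, level_add, Nat.cast_one]
    have hpos := level_pos hnu k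
    simp only [lowerSeq, raiseSeq, hsucc]
    exact lowerPoly_raisePoly (level_pos hnu N).ne' hpos.ne' (by positivity) w

theorem lowerChain_mem_degreeLT (h : p.IsRomanovski N q) (hnu : -1 < p.nu) (hscale : p.scale ≠ 0)
    (k : ℕ) : lowerChain (p.lowerSeq N) k q ∈ degreeLT ℂ (N + 1 - k) := by
  induction k with
  | zero => exact h.mem
  | succ k ih =>
    rw [lowerChain_succ_apply]
    rcases le_or_gt k N with hk | hk
    · obtain ⟨d, rfl⟩ := Nat.exists_eq_add_of_le' hk
      have heigen := (h.factorizationChain hnu).raise_lower_lowerChain k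
      rw [show d + k + 1 - k = d + 1 by omega] at ih
      rw [show d + k + 1 - (k + 1) = d by omega]
      simp only [lowerSeq, raiseSeq, level_add] at ih heigen ⊢
      exact lowerPoly_mem_degreeLT hscale (level_pos hnu k).ne' ih heigen
    · have hzero : lowerChain (p.lowerSeq N) k q = 0 := by
        rw [Nat.sub_eq_zero_of_le hk, mem_degreeLT_iff_coeff] at ih
        exact Polynomial.ext fun i => ih i i.zero_le
      rw [hzero, map_zero]
      exact zero_mem _

theorem natDegree_lowerChain_lt (h : p.IsRomanovski N q) (hnu : -1 < p.nu) (hscale : p.scale ≠ 0)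
    (k : ℕ) : ((lowerChain (p.lowerSeq N) k q).natDegree : ℝ) < p.level N := by
  have hmem := degreeLT_mono (Nat.sub_le _ _) (h.lowerChain_mem_degreeLT hnu hscale k)
  have hle : (lowerChain (p.lowerSeq N) k q).natDegree ≤ N :=
    natDegree_le_iff_coeff_eq_zero.mpr (mem_degreeLT_iff_coeff.mp hmem)
  calc ((lowerChain (p.lowerSeq N) k q).natDegree : ℝ) ≤ N := mod_cast hle
    _ < p.level N := by unfold level; linarith

theorem exists_lowerChain_eq_C (h : p.IsRomanovski N q) (hnu : -1 < p.nu) (hscale : p.scale ≠ 0)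
    (hq : q ≠ 0) : ∃ c : ℂ, c ≠ 0 ∧ lowerChain (p.lowerSeq N) N q = C c := by
  have hmem := h.lowerChain_mem_degreeLT hnu hscale N
  have hne : lowerChain (p.lowerSeq N) N q ≠ 0 := by
    refine (h.factorizationChain hnu).lowerChain_ne_zero hq fun k hk => ?_
    exact_mod_cast (gap_level_pos hnu hscale hk).ne'
  rw [Nat.add_sub_cancel_left, mem_degreeLT_iff_coeff] at hmem
  have hconst := eq_C_of_natDegree_le_zero (natDegree_le_iff_coeff_eq_zero.mpr hmem)
  exact ⟨_, fun h0 => hne (by rw [hconst, h0, C_0]), hconst⟩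

end IsRomanovski

/-- The polynomial in `cot (πx/L)` of the eigenfunction before normalization. -/
noncomputable def rawPoly (p : PTParams) (N : ℕ) : ℂ[X] :=
  (jacobiPoly N (p.jacobiParam N) (star (p.jacobiParam N))).comp (C (Complex.I / 2) * X - C (1 / 2))

theorem jacobiParam_eq (N : ℕ) :
    p.jacobiParam N = -(p.level N : ℂ) + Complex.I * (p.beta / p.level N) := by
  rw [← Complex.ofReal_div]
  apply Complex.ext <;> simp [jacobiParam, level, -Complex.ofReal_div]

theorem star_jacobiParam_eq (N : ℕ) :
    star (p.jacobiParam N) = -(p.level N : ℂ) - Complex.I * (p.beta / p.level N) := by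
  rw [jacobiParam_eq]
  simp [sub_eq_add_neg]

theorem natDegree_rawPoly_le (N : ℕ) : (p.rawPoly N).natDegree ≤ N := by
  have hlin : (C (Complex.I / 2) * X - C (1 / 2) : ℂ[X]).natDegree ≤ 1 := by compute_degree
  rw [rawPoly, natDegree_comp]
  exact (Nat.mul_le_mul (natDegree_jacobiPoly_le N _ _) hlin).trans_eq (mul_one N)

theorem rawPoly_ne_zero (hnu : -1 < p.nu) (N : ℕ) : p.rawPoly N ≠ 0 := by
  have hJ : jacobiPoly N (p.jacobiParam N) (star (p.jacobiParam N)) ≠ 0 := by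
    refine jacobiPoly_ne_zero _ _ _ fun k hk hroot => ?_
    have hreal : (k : ℝ) = N + 2 * p.nu + 1 := by
      apply Complex.ofReal_injective
      rw [Complex.ofReal_natCast, hroot, star_jacobiParam_eq, jacobiParam_eq, level]
      push_cast
      ring
    have hk' : (k : ℝ) + 1 ≤ N := mod_cast hk
    linarith
  intro h0
  rcases comp_eq_zero_iff.mp h0 with hzero | ⟨-, hconst⟩
  · exact hJ hzero
  · simpa [coeff_C] using congrArg (coeff · 1) hconst

theorem isRomanovski_rawPoly (N : ℕ) : p.IsRomanovski N (p.rawPoly N) where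
  mem := mem_degreeLT_iff_coeff.mpr (natDegree_le_iff_coeff_eq_zero.mp (natDegree_rawPoly_le N))
  ode := by
    have hN : (N : ℂ) = p.level N - p.level 0 := by simp [level]
    apply Polynomial.funext
    intro t
    have ode := congrArg (eval (Complex.I / 2 * t - 1 / 2))
      (jacobiPoly_ode N (p.jacobiParam N) (star (p.jacobiParam N)))
    rw [romanovskiOp_apply, rawPoly]
    generalize jacobiPoly N (p.jacobiParam N) (star (p.jacobiParam N)) = J at ode ⊢
    rw [star_jacobiParam_eq, jacobiParam_eq, hN] at ode
    simp only [derivative_add, derivative_sub, derivative_mul, derivative_C, derivative_X,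
      derivative_comp, eval_comp, eval_add, eval_sub, eval_mul, eval_C, eval_X, eval_one,
      derivative_one, derivative_zero, eval_zero, eval_pow] at ode ⊢
    linear_combination ode + (derivative (derivative J)).eval (Complex.I / 2 * t - 1 / 2) / 4 *
      Complex.I_sq

end LadderPolynomials

section Wave

/-- The function `cot (πx/L)`. -/
noncomputable def cotAngle (p : PTParams) (x : ℝ) : ℝ := Real.cot (Real.pi * x / p.L)

/-- The common factor `sin^s (πx/L) exp (-βπx/(Ls))` of an eigenfunction `φ_N` and its descendants,
where `s = N + ν + 1`. -/
noncomputable def envelope (p : PTParams) (s x : ℝ) : ℝ :=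
  Real.sin (Real.pi * x / p.L) ^ s * Real.exp (-(p.beta * Real.pi * x / (p.L * s)))

/-- The function whose polynomial factor is `q`: all functions in the hierarchy have this form. -/
noncomputable def wave (p : PTParams) (s : ℝ) (q : ℂ[X]) (x : ℝ) : ℂ :=
  (p.envelope s x : ℂ) * q.eval (p.cotAngle x : ℂ)

theorem wave_smul (s : ℝ) (c : ℂ) (q : ℂ[X]) (x : ℝ) :
    p.wave s (c • q) x = c * p.wave s q x := by
  rw [wave, wave, eval_smul, smul_eq_mul, mul_left_comm]

theorem wave_lowerPoly (s r : ℝ) (q : ℂ[X]) (x : ℝ) :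
    p.wave s (p.lowerPoly s r q) x = p.hbar * p.wave s (p.derivPoly s q) x +
      (p.superPoly r).eval (p.cotAngle x : ℂ) * p.wave s q x := by
  simp only [wave, lowerPoly, LinearMap.add_apply, LinearMap.smul_apply, LinearMap.mulLeft_apply,
    eval_add, eval_smul, eval_mul, smul_eq_mul]
  ring

theorem wave_raisePoly (s r : ℝ) (q : ℂ[X]) (x : ℝ) :
    p.wave s (p.raisePoly s r q) x = -p.hbar * p.wave s (p.derivPoly s q) x +
      (p.superPoly r).eval (p.cotAngle x : ℂ) * p.wave s q x := by
  simp only [wave, raisePoly, LinearMap.add_apply, LinearMap.neg_apply, LinearMap.smul_apply,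
    LinearMap.mulLeft_apply, eval_add, eval_neg, eval_smul, eval_mul, smul_eq_mul]
  ring

theorem star_eval_superPoly (r y : ℝ) :
    star ((p.superPoly r).eval (y : ℂ)) = (p.superPoly r).eval (y : ℂ) := by
  simp [superPoly]

theorem wave_zero_right {s : ℝ} (hs : s ≠ 0) (q : ℂ[X]) : p.wave s q 0 = 0 := by
  simp [wave, envelope, Real.zero_rpow hs]

theorem wave_length_right (hL : p.L ≠ 0) {s : ℝ} (hs : s ≠ 0) (q : ℂ[X]) : p.wave s q p.L = 0 := by
  simp [wave, envelope, mul_div_cancel_right₀ _ hL, Real.zero_rpow hs]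

theorem sin_pos_of_mem_Ioo {x : ℝ} (hx : x ∈ Set.Ioo 0 p.L) : 0 < Real.sin (Real.pi * x / p.L) := by
  have hL : 0 < p.L := hx.1.trans hx.2
  refine Real.sin_pos_of_pos_of_lt_pi (div_pos (mul_pos Real.pi_pos hx.1) hL) ?_
  rw [div_lt_iff₀ hL]
  exact mul_lt_mul_of_pos_left hx.2 Real.pi_pos

theorem envelope_pos (s : ℝ) {x : ℝ} (hx : x ∈ Set.Ioo 0 p.L) : 0 < p.envelope s x :=
  mul_pos (Real.rpow_pos_of_pos (sin_pos_of_mem_Ioo hx) s) (Real.exp_pos _)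

theorem wave_C_ne_zero (s : ℝ) {c : ℂ} (hc : c ≠ 0) {x : ℝ} (hx : x ∈ Set.Ioo 0 p.L) :
    p.wave s (C c) x ≠ 0 := by
  rw [wave, eval_C]
  exact mul_ne_zero (Complex.ofReal_ne_zero.mpr (envelope_pos s hx).ne') hc

theorem exists_cotAngle_eq (hL : 0 < p.L) (t : ℝ) : ∃ x ∈ Set.Ioo 0 p.L, p.cotAngle x = t := by
  have hangle : Real.pi * (p.L / Real.pi * (Real.pi / 2 - Real.arctan t)) / p.L =
      Real.pi / 2 - Real.arctan t := by
    field_simp [Real.pi_ne_zero]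
  have hupper : Real.pi / 2 - Real.arctan t < Real.pi := by
    linarith [Real.neg_pi_div_two_lt_arctan t]
  refine ⟨p.L / Real.pi * (Real.pi / 2 - Real.arctan t), ⟨?_, ?_⟩, ?_⟩
  · exact mul_pos (div_pos hL Real.pi_pos) (sub_pos.mpr (Real.arctan_lt_pi_div_two t))
  · calc p.L / Real.pi * (Real.pi / 2 - Real.arctan t) < p.L / Real.pi * Real.pi := by gcongr
      _ = p.L := div_mul_cancel₀ _ Real.pi_ne_zero
  · rw [cotAngle, hangle, Real.cot_eq_cos_div_sin, Real.cos_pi_div_two_sub,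
      Real.sin_pi_div_two_sub, ← Real.tan_eq_sin_div_cos, Real.tan_arctan]

theorem exists_wave_ne_zero (hL : 0 < p.L) (s : ℝ) {q : ℂ[X]} (hq : q ≠ 0) :
    ∃ x ∈ Set.Ioo 0 p.L, p.wave s q x ≠ 0 := by
  by_contra! hzero
  refine hq (eq_zero_of_infinite_isRoot q
    (Set.infinite_of_injective_forall_mem Complex.ofReal_injective fun t => ?_))
  obtain ⟨x, hx, rfl⟩ := exists_cotAngle_eq hL t
  exact (mul_eq_zero.mp (hzero x hx)).resolve_left
    (Complex.ofReal_ne_zero.mpr (envelope_pos s hx).ne')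

theorem hasDerivAt_angle (x : ℝ) :
    HasDerivAt (fun x : ℝ => Real.pi * x / p.L) (Real.pi / p.L) x := by
  simpa using ((hasDerivAt_id x).const_mul Real.pi).div_const p.L

theorem hasDerivAt_cotAngle {x : ℝ} (hx : x ∈ Set.Ioo 0 p.L) :
    HasDerivAt p.cotAngle (-(Real.pi / p.L * (1 + p.cotAngle x ^ 2))) x := by
  have hsin := (sin_pos_of_mem_Ioo hx).ne'
  have hcot : p.cotAngle = fun x => Real.cos (Real.pi * x / p.L) / Real.sin (Real.pi * x / p.L) :=
    funext fun x => Real.cot_eq_cos_div_sin _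
  rw [hcot]
  refine ((hasDerivAt_angle x).cos.div (hasDerivAt_angle x).sin hsin).congr_deriv ?_
  field_simp
  ring

theorem hasDerivAt_envelope (s : ℝ) {x : ℝ} (hx : x ∈ Set.Ioo 0 p.L) :
    HasDerivAt (p.envelope s)
      (Real.pi / p.L * (s * p.cotAngle x - p.beta / s) * p.envelope s x) x := by
  have hsin := (sin_pos_of_mem_Ioo hx).ne'
  have hpow := (hasDerivAt_angle x).sin.rpow_const (p := s) (Or.inl hsin)
  have hexp : HasDerivAt (fun x : ℝ => -(p.beta * Real.pi * x / (p.L * s)))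
      (-(p.beta * Real.pi / (p.L * s))) x := by
    simpa using (((hasDerivAt_id x).const_mul (p.beta * Real.pi)).div_const (p.L * s)).fun_neg
  refine (hpow.mul hexp.exp).congr_deriv ?_
  rw [Real.rpow_sub_one hsin, envelope, cotAngle, Real.cot_eq_cos_div_sin]
  ring

theorem hasDerivAt_wave (s : ℝ) (q : ℂ[X]) {x : ℝ} (hx : x ∈ Set.Ioo 0 p.L) :
    HasDerivAt (p.wave s q) (p.wave s (p.derivPoly s q) x) x := by
  have heval := (q.hasDerivAt _).comp x (hasDerivAt_cotAngle hx).ofReal_comp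
  refine ((hasDerivAt_envelope s hx).ofReal_comp.mul heval).congr_deriv ?_
  simp only [wave, derivPoly, LinearMap.smul_apply, LinearMap.sub_apply, LinearMap.mulLeft_apply,
    LinearMap.comp_apply, eval_smul, eval_sub, eval_mul, eval_add, eval_C, eval_X, eval_pow,
    eval_one, smul_eq_mul, Function.comp_apply]
  push_cast
  ring

theorem contDiffOn_wave (s : ℝ) (q : ℂ[X]) : ContDiffOn ℝ ∞ (p.wave s q) (Set.Ioo 0 p.L) := by
  have hangle : ContDiff ℝ ∞ (fun x : ℝ => Real.pi * x / p.L) := by fun_prop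
  have hsin : ∀ x ∈ Set.Ioo 0 p.L, Real.sin (Real.pi * x / p.L) ≠ 0 :=
    fun x hx => (sin_pos_of_mem_Ioo hx).ne'
  have henvelope : ContDiffOn ℝ ∞ (p.envelope s) (Set.Ioo 0 p.L) :=
    (hangle.sin.contDiffOn.rpow_const_of_ne hsin).mul (by fun_prop)
  have hcot : ContDiffOn ℝ ∞ p.cotAngle (Set.Ioo 0 p.L) :=
    (hangle.cos.contDiffOn.div hangle.sin.contDiffOn hsin).congr
      fun x _ => Real.cot_eq_cos_div_sin _
  have hofReal : ContDiff ℝ ∞ (fun x : ℝ => (x : ℂ)) := Complex.ofRealCLM.contDiff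
  have heval : ContDiff ℝ ∞ (fun z : ℂ => q.eval z) := by
    simpa using (contDiff_aeval (𝕜 := ℂ) q ∞).restrict_scalars ℝ
  exact (hofReal.comp_contDiffOn henvelope).mul
    (heval.comp_contDiffOn (hofReal.comp_contDiffOn hcot))

theorem continuousOn_envelope_mul_cotAngle_pow (hL : 0 < p.L) {s : ℝ} {i : ℕ} (hi : (i : ℝ) < s) :
    ContinuousOn (fun x => p.envelope s x * p.cotAngle x ^ i) (Set.Icc 0 p.L) := by
  have hpow : Continuous fun x : ℝ => Real.sin (Real.pi * x / p.L) ^ (s - i) :=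
    Continuous.rpow_const (by fun_prop) fun _ => Or.inr (sub_nonneg.mpr hi.le)
  have hcont : Continuous fun x : ℝ => Real.exp (-(p.beta * Real.pi * x / (p.L * s))) *
      (Real.sin (Real.pi * x / p.L) ^ (s - i) * Real.cos (Real.pi * x / p.L) ^ i) := by
    fun_prop
  refine hcont.continuousOn.congr fun x hx => ?_
  have hs : s ≠ 0 := (i.cast_nonneg.trans_lt hi).ne'
  have hsin : 0 ≤ Real.sin (Real.pi * x / p.L) := by
    refine Real.sin_nonneg_of_nonneg_of_le_pi ?_ ?_
    · exact div_nonneg (mul_nonneg Real.pi_pos.le hx.1) hL.le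
    · rw [div_le_iff₀ hL]
      exact mul_le_mul_of_nonneg_left hx.2 Real.pi_pos.le
  simp only [envelope, cotAngle]
  rcases hsin.eq_or_lt with hzero | hpos
  · rw [← hzero, Real.zero_rpow hs, Real.zero_rpow (sub_pos.mpr hi).ne']
    ring
  · rw [Real.rpow_sub_natCast hpos.ne', Real.cot_eq_cos_div_sin, div_pow]
    ring

theorem continuousOn_wave (hL : 0 < p.L) {s : ℝ} {q : ℂ[X]} (hq : (q.natDegree : ℝ) < s) :
    ContinuousOn (p.wave s q) (Set.Icc 0 p.L) := by
  have hsum : p.wave s q = fun x => ∑ i ∈ Finset.range (q.natDegree + 1),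
      q.coeff i * ((p.envelope s x * p.cotAngle x ^ i : ℝ) : ℂ) := by
    funext x
    rw [wave, eval_eq_sum_range, Finset.mul_sum]
    refine Finset.sum_congr rfl fun i _ => ?_
    push_cast
    ring
  rw [hsum]
  refine continuousOn_finsetSum _ fun i hi => continuousOn_const.mul ?_
  have hle : (i : ℝ) ≤ q.natDegree := mod_cast Finset.mem_range_succ_iff.mp hi
  exact Complex.continuous_ofReal.comp_continuousOn
    (continuousOn_envelope_mul_cotAngle_pow hL (hle.trans_lt hq))

/-- The inner product of `L²([0, L])` on the functions `wave p s q`. -/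
noncomputable def waveInner (p : PTParams) (s : ℝ) (f g : ℂ[X]) : ℂ :=
  ∫ x in (0 : ℝ)..p.L, star (p.wave s f x) * p.wave s g x

theorem waveInner_smul_right (s : ℝ) (c : ℂ) (f g : ℂ[X]) :
    p.waveInner s f (c • g) = c * p.waveInner s f g := by
  simp only [waveInner, wave_smul, mul_left_comm _ c, intervalIntegral.integral_const_mul]

theorem waveInner_smul_left (s : ℝ) (c : ℂ) (f g : ℂ[X]) :
    p.waveInner s (c • f) g = star c * p.waveInner s f g := by
  simp only [waveInner, wave_smul, star_mul', mul_assoc, intervalIntegral.integral_const_mul]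

theorem waveInner_self (s : ℝ) (q : ℂ[X]) :
    p.waveInner s q q = ((∫ x in (0 : ℝ)..p.L, ‖p.wave s q x‖ ^ 2 : ℝ) : ℂ) := by
  rw [waveInner, ← intervalIntegral.integral_ofReal]
  refine intervalIntegral.integral_congr fun x _ => ?_
  simpa using Complex.conj_mul' (p.wave s q x)

theorem waveInner_inv_sqrt_smul_self {s a : ℝ} (ha : 0 < a) {q : ℂ[X]}
    (hq : p.waveInner s q q = (a : ℂ)) :
    p.waveInner s ((((√a)⁻¹ : ℝ) : ℂ) • q) ((((√a)⁻¹ : ℝ) : ℂ) • q) = 1 := by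
  have hsqrt : (√a)⁻¹ * ((√a)⁻¹ * a) = 1 := by
    rw [← mul_assoc, ← mul_inv, Real.mul_self_sqrt ha.le, inv_mul_cancel₀ ha.ne']
  have hstar : star (((√a)⁻¹ : ℝ) : ℂ) = ((√a)⁻¹ : ℝ) := Complex.conj_ofReal _
  rw [waveInner_smul_left, waveInner_smul_right, hq, hstar]
  exact_mod_cast hsqrt

theorem integral_norm_wave_sq_pos (hL : 0 < p.L) {s : ℝ} {q : ℂ[X]} (hdeg : (q.natDegree : ℝ) < s)
    (hq : q ≠ 0) : 0 < ∫ x in (0 : ℝ)..p.L, ‖p.wave s q x‖ ^ 2 := by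
  obtain ⟨x, hx, hne⟩ := exists_wave_ne_zero hL s hq
  exact intervalIntegral.integral_pos hL ((continuousOn_wave hL hdeg).norm.pow 2)
    (fun _ _ => sq_nonneg _) ⟨x, Set.Ioo_subset_Icc_self hx, pow_pos (norm_pos_iff.mpr hne) 2⟩

theorem waveInner_lowerPoly_left (hL : 0 < p.L) {s r : ℝ} {f g : ℂ[X]}
    (hf : (f.natDegree : ℝ) < s) (hg : (g.natDegree : ℝ) < s)
    (hlower : ((p.lowerPoly s r f).natDegree : ℝ) < s)
    (hraise : ((p.raisePoly s r g).natDegree : ℝ) < s) :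
    p.waveInner s (p.lowerPoly s r f) g = p.waveInner s f (p.raisePoly s r g) := by
  have hs : s ≠ 0 := (Nat.cast_nonneg _ |>.trans_lt hf).ne'
  have hleft : IntervalIntegrable (fun x => star (p.wave s (p.lowerPoly s r f) x) * p.wave s g x)
      volume 0 p.L := ((continuousOn_wave hL hlower).star.mul
    (continuousOn_wave hL hg)).intervalIntegrable_of_Icc hL.le
  have hright : IntervalIntegrable (fun x => star (p.wave s f x) * p.wave s (p.raisePoly s r g) x)
      volume 0 p.L := ((continuousOn_wave hL hf).star.mul
    (continuousOn_wave hL hraise)).intervalIntegrable_of_Icc hL.le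
  have hderiv : ∀ x ∈ Set.Ioo 0 p.L, HasDerivAt
      (fun x => (p.hbar : ℂ) * (star (p.wave s f x) * p.wave s g x))
      (star (p.wave s (p.lowerPoly s r f) x) * p.wave s g x -
        star (p.wave s f x) * p.wave s (p.raisePoly s r g) x) x := by
    intro x hx
    refine (((hasDerivAt_wave s f hx).star.mul
      (hasDerivAt_wave s g hx)).const_mul (p.hbar : ℂ)).congr_deriv ?_
    have hstar : star (p.hbar : ℂ) = p.hbar := Complex.conj_ofReal _
    simp only [wave_lowerPoly, wave_raisePoly, star_add, star_mul', star_eval_superPoly, hstar]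
    ring
  have hcont : ContinuousOn (fun x => (p.hbar : ℂ) * (star (p.wave s f x) * p.wave s g x))
      (Set.Icc 0 p.L) :=
    continuousOn_const.mul ((continuousOn_wave hL hf).star.mul (continuousOn_wave hL hg))
  have hboundary := intervalIntegral.integral_eq_sub_of_hasDerivAt_of_le hL.le hcont hderiv
    (hleft.sub hright)
  rw [intervalIntegral.integral_sub hleft hright, wave_length_right hL.ne' hs f,
    wave_zero_right hs f,
    star_zero, zero_mul, zero_mul, sub_self] at hboundary
  exact sub_eq_zero.mp hboundary

end Wave

section Hierarchy

/-- The polynomial in `cot (πx/L)` of the normalized eigenfunction `φ_N`. -/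
noncomputable def phiPoly (p : PTParams) (N : ℕ) : ℂ[X] := (p.normConst N : ℂ) • p.rawPoly N

theorem rawEigenfunction_eq_wave (N : ℕ) :
    p.rawEigenfunction N = p.wave (p.level N) (p.rawPoly N) := by
  funext x
  have hlevel : p.nu + (N : ℝ) + 1 = p.level N := by rw [level, add_comm p.nu]
  have harg : Complex.I / 2 * (p.cotAngle x : ℂ) - 1 / 2 =
      (Complex.I * (p.cotAngle x : ℂ) - 1) / 2 := by ring
  rw [wave, rawPoly, eval_comp, eval_sub, eval_mul, eval_C, eval_X, eval_C, harg, eval_jacobiPoly,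
    rawEigenfunction, hlevel, envelope, cotAngle]

theorem phi_eq_wave (N : ℕ) : p.phi N = p.wave (p.level N) (p.phiPoly N) := by
  funext x
  rw [phi, rawEigenfunction_eq_wave, phiPoly, wave_smul]

theorem phi_eqOn (N : ℕ) :
    Set.EqOn (p.phi N) (p.wave (p.level N) (p.phiPoly N)) (Set.Ioo 0 p.L) :=
  fun x _ => congrFun (phi_eq_wave N) x

theorem isRomanovski_phiPoly (N : ℕ) : p.IsRomanovski N (p.phiPoly N) :=
  (isRomanovski_rawPoly N).const_smul _

theorem waveInner_phiPoly (hL : 0 < p.L) (hnu : -1 < p.nu) (hscale : p.scale ≠ 0) (N : ℕ) :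
    p.waveInner (p.level N) (p.phiPoly N) (p.phiPoly N) = 1 := by
  have hdeg := (isRomanovski_rawPoly (p := p) N).natDegree_lowerChain_lt hnu hscale 0
  rw [phiPoly, normConst, rawEigenfunction_eq_wave]
  exact waveInner_inv_sqrt_smul_self (integral_norm_wave_sq_pos hL hdeg (rawPoly_ne_zero hnu N))
    (waveInner_self _ _)

theorem phiPoly_ne_zero (hL : 0 < p.L) (hnu : -1 < p.nu) (hscale : p.scale ≠ 0) (N : ℕ) :
    p.phiPoly N ≠ 0 := by
  intro hzero
  have hnorm := waveInner_phiPoly hL hnu hscale N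
  simp [hzero, waveInner, wave] at hnorm

theorem IsRomanovski.waveInner_lowerChain {N : ℕ} {q : ℂ[X]} (h : p.IsRomanovski N q)
    (hL : 0 < p.L) (hnu : -1 < p.nu) (hscale : p.scale ≠ 0) (k : ℕ) :
    p.waveInner (p.level N) (lowerChain (p.lowerSeq N) k q) (lowerChain (p.lowerSeq N) k q) =
      (∏ i ∈ Finset.range k, (p.gap (p.level N) (p.level i) : ℂ)) *
        p.waveInner (p.level N) q q := by
  induction k with
  | zero => rw [Finset.prod_range_zero, one_mul]; rfl
  | succ k ih =>
    have hdeg := h.natDegree_lowerChain_lt hnu hscale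
    have heigen := (h.factorizationChain hnu).raise_lower_lowerChain k
    have hlower := hdeg (k + 1)
    rw [lowerChain_succ_apply] at hlower ⊢
    have hraise : ((p.raiseSeq N k (p.lowerSeq N k (lowerChain (p.lowerSeq N) k q))).natDegree : ℝ)
        < p.level N := by
      rw [heigen]
      exact (Nat.cast_le.mpr (natDegree_smul_le _ _)).trans_lt (hdeg k)
    rw [waveInner_lowerPoly_left hL (hdeg k) hlower hlower hraise, heigen, waveInner_smul_right, ih,
      Finset.prod_range_succ_comm, mul_assoc]

/-- The polynomial in `cot (πx/L)` of the eigenfunction `φ_j^{(k)}`. -/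
noncomputable def eigenPoly (p : PTParams) (k j : ℕ) : ℂ[X] :=
  (((√(∏ i ∈ Finset.range k, p.gap (p.level (j + k)) (p.level i)))⁻¹ : ℝ) : ℂ) •
    lowerChain (p.lowerSeq (j + k)) k (p.phiPoly (j + k))

theorem waveInner_eigenPoly (hL : 0 < p.L) (hnu : -1 < p.nu) (hscale : p.scale ≠ 0) (k j : ℕ) :
    p.waveInner (p.level (j + k)) (p.eigenPoly k j) (p.eigenPoly k j) = 1 := by
  refine waveInner_inv_sqrt_smul_self (prod_gap_pos hnu hscale (k.le_add_left j)) ?_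
  rw [(isRomanovski_phiPoly _).waveInner_lowerChain hL hnu hscale, waveInner_phiPoly hL hnu hscale,
    mul_one, Complex.ofReal_prod]

theorem natDegree_eigenPoly_lt (hnu : -1 < p.nu) (hscale : p.scale ≠ 0) (k j : ℕ) :
    ((p.eigenPoly k j).natDegree : ℝ) < p.level (j + k) :=
  (Nat.cast_le.mpr (natDegree_smul_le _ _)).trans_lt
    ((isRomanovski_phiPoly _).natDegree_lowerChain_lt hnu hscale k)

theorem exists_eigenPoly_zero_eq_C (hL : 0 < p.L) (hnu : -1 < p.nu) (hscale : p.scale ≠ 0)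
    (k : ℕ) : ∃ c : ℂ, c ≠ 0 ∧ p.eigenPoly k 0 = C c := by
  obtain ⟨c, hc, hconst⟩ := (isRomanovski_phiPoly k).exists_lowerChain_eq_C hnu hscale
    (phiPoly_ne_zero hL hnu hscale k)
  have hpos := prod_gap_pos hnu hscale (le_refl k)
  refine ⟨_, mul_ne_zero (Complex.ofReal_ne_zero.mpr (inv_pos.mpr (Real.sqrt_pos.mpr hpos)).ne')
    hc, ?_⟩
  rw [C_mul, ← hconst, ← smul_eq_C_mul, eigenPoly, zero_add]

theorem lowerWith_eqOn {s r : ℝ} {q : ℂ[X]} {W f : ℝ → ℂ}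
    (hf : Set.EqOn f (p.wave s q) (Set.Ioo 0 p.L))
    (hW : Set.EqOn W (fun x => (p.superPoly r).eval (p.cotAngle x : ℂ)) (Set.Ioo 0 p.L)) :
    Set.EqOn (p.lowerWith W f) (p.wave s (p.lowerPoly s r q)) (Set.Ioo 0 p.L) := by
  intro x hx
  rw [lowerWith, (hf.eventuallyEq_of_mem (isOpen_Ioo.mem_nhds hx)).deriv_eq,
    (hasDerivAt_wave s q hx).deriv, hf hx, hW hx, wave_lowerPoly]

theorem raiseWith_eqOn {s r : ℝ} {q : ℂ[X]} {W f : ℝ → ℂ}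
    (hf : Set.EqOn f (p.wave s q) (Set.Ioo 0 p.L))
    (hW : Set.EqOn W (fun x => (p.superPoly r).eval (p.cotAngle x : ℂ)) (Set.Ioo 0 p.L)) :
    Set.EqOn (p.raiseWith W f) (p.wave s (p.raisePoly s r q)) (Set.Ioo 0 p.L) := by
  intro x hx
  rw [raiseWith, (hf.eventuallyEq_of_mem (isOpen_Ioo.mem_nhds hx)).deriv_eq,
    (hasDerivAt_wave s q hx).deriv, hf hx, hW hx, wave_raisePoly]

theorem superpotentialOf_eqOn {r : ℝ} {c : ℂ} (hc : c ≠ 0) {g : ℝ → ℂ}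
    (hg : Set.EqOn g (p.wave r (C c)) (Set.Ioo 0 p.L)) :
    Set.EqOn (p.superpotentialOf g) (fun x => (p.superPoly r).eval (p.cotAngle x : ℂ))
      (Set.Ioo 0 p.L) := by
  intro x hx
  have hderiv : (p.hbar : ℂ) * p.wave r (p.derivPoly r (C c)) x =
      -((p.superPoly r).eval (p.cotAngle x : ℂ) * p.wave r (C c) x) := by
    rw [← wave_smul, hbar_smul_derivPoly_C, wave, wave, eval_neg, eval_mul]
    ring
  rw [superpotentialOf, (hg.eventuallyEq_of_mem (isOpen_Ioo.mem_nhds hx)).deriv_eq,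
    (hasDerivAt_wave r _ hx).deriv, hg hx, neg_mul, hderiv, neg_neg]
  exact mul_div_cancel_right₀ _ (wave_C_ne_zero r hc hx)

theorem hierState_eqOn (hmass : p.mass ≠ 0) (hL : p.L ≠ 0) (hnu : -1 < p.nu) {k j : ℕ}
    {T : (ℝ → ℂ) → ℝ → ℂ} (hT : Set.EqOn (T (p.phi (j + k)))
      (p.wave (p.level (j + k)) (lowerChain (p.lowerSeq (j + k)) k (p.phiPoly (j + k))))
      (Set.Ioo 0 p.L)) :
    Set.EqOn (p.hierState T k j) (p.wave (p.level (j + k)) (p.eigenPoly k j))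
      (Set.Ioo 0 p.L) := by
  intro x hx
  have hprod : (2 * p.mass) ^ k * ∏ i ∈ Finset.range k, (p.energy (j + k) - p.energy i) =
      ∏ i ∈ Finset.range k, p.gap (p.level (j + k)) (p.level i) := by
    simpa only [Finset.card_range, two_mass_mul_energy_sub hmass hL hnu] using
      Finset.pow_card_mul_prod (s := Finset.range k) (b := 2 * p.mass)
        (f := fun i => p.energy (j + k) - p.energy i)
  rw [hierState, hprod, hT hx, eigenPoly, wave_smul, Complex.ofReal_inv, div_eq_inv_mul]

theorem lowerProd_eqOn (hhbar : p.hbar ≠ 0) (hmass : p.mass ≠ 0) (hL : 0 < p.L) (hnu : -1 < p.nu)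
    (k : ℕ) {N : ℕ} {q : ℂ[X]} {f : ℝ → ℂ}
    (hf : Set.EqOn f (p.wave (p.level N) q) (Set.Ioo 0 p.L)) :
    Set.EqOn (p.lowerProd k f) (p.wave (p.level N) (lowerChain (p.lowerSeq N) k q))
      (Set.Ioo 0 p.L) := by
  induction k generalizing N q f with
  | zero => exact hf
  | succ k ih =>
    obtain ⟨c, hc, hconst⟩ := exists_eigenPoly_zero_eq_C hL hnu (scale_ne_zero hhbar hL.ne') k
    have hground := hierState_eqOn (k := k) (j := 0) hmass hL.ne' hnu
      (ih (phi_eqOn _))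
    rw [hconst, zero_add] at hground
    rw [lowerChain_succ_apply]
    exact lowerWith_eqOn (ih hf) (superpotentialOf_eqOn hc hground)

theorem eigenfunction_eqOn (hhbar : p.hbar ≠ 0) (hmass : p.mass ≠ 0) (hL : 0 < p.L)
    (hnu : -1 < p.nu) (k j : ℕ) :
    Set.EqOn (p.eigenfunction k j) (p.wave (p.level (j + k)) (p.eigenPoly k j)) (Set.Ioo 0 p.L) :=
  hierState_eqOn hmass hL.ne' hnu (lowerProd_eqOn hhbar hmass hL hnu k
    (phi_eqOn _))

theorem eigenfunction_zero_ne_zero (hhbar : p.hbar ≠ 0) (hmass : p.mass ≠ 0) (hL : 0 < p.L)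
    (hnu : -1 < p.nu) (k : ℕ) {x : ℝ} (hx : x ∈ Set.Ioo 0 p.L) : p.eigenfunction k 0 x ≠ 0 := by
  obtain ⟨c, hc, hconst⟩ := exists_eigenPoly_zero_eq_C hL hnu (scale_ne_zero hhbar hL.ne') k
  rw [eigenfunction_eqOn hhbar hmass hL hnu k 0 hx, hconst]
  exact wave_C_ne_zero _ hc hx

theorem superpotential_eqOn (hhbar : p.hbar ≠ 0) (hmass : p.mass ≠ 0) (hL : 0 < p.L)
    (hnu : -1 < p.nu) (k : ℕ) :
    Set.EqOn (p.superpotential k) (fun x => (p.superPoly (p.level k)).eval (p.cotAngle x : ℂ))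
      (Set.Ioo 0 p.L) := by
  obtain ⟨c, hc, hconst⟩ := exists_eigenPoly_zero_eq_C hL hnu (scale_ne_zero hhbar hL.ne') k
  have hground := eigenfunction_eqOn hhbar hmass hL hnu k 0
  rw [hconst, zero_add] at hground
  exact superpotentialOf_eqOn hc hground

theorem opB_eqOn (hhbar : p.hbar ≠ 0) (hmass : p.mass ≠ 0) (hL : 0 < p.L) (hnu : -1 < p.nu)
    (m : ℕ) {N : ℕ} {q : ℂ[X]} {f : ℝ → ℂ}
    (hf : Set.EqOn f (p.wave (p.level N) q) (Set.Ioo 0 p.L)) :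
    Set.EqOn (p.opB m f) (p.wave (p.level N) (lowerChain (p.lowerSeq N) (m + 1) q))
      (Set.Ioo 0 p.L) := by
  rw [← lowerProd_succ_eq_opB]
  exact lowerProd_eqOn hhbar hmass hL hnu (m + 1) hf

theorem opBdag_eqOn (hhbar : p.hbar ≠ 0) (hmass : p.mass ≠ 0) (hL : 0 < p.L) (hnu : -1 < p.nu)
    (m : ℕ) {N : ℕ} {q : ℂ[X]} {f : ℝ → ℂ}
    (hf : Set.EqOn f (p.wave (p.level N) q) (Set.Ioo 0 p.L)) :
    Set.EqOn (p.opBdag m f) (p.wave (p.level N) (raiseChain (p.raiseSeq N) (m + 1) q))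
      (Set.Ioo 0 p.L) := by
  have hraise (k : ℕ) {q : ℂ[X]} {f : ℝ → ℂ}
      (hf : Set.EqOn f (p.wave (p.level N) q) (Set.Ioo 0 p.L)) :
      Set.EqOn (p.opAdag k f) (p.wave (p.level N) (p.raiseSeq N k q)) (Set.Ioo 0 p.L) :=
    raiseWith_eqOn hf (superpotential_eqOn hhbar hmass hL hnu k)
  induction m generalizing q f with
  | zero => exact hraise 0 hf
  | succ m ih =>
    rw [raiseChain_succ_apply]
    exact ih (hraise (m + 1) hf)

theorem inL2_of_eqOn (hL : 0 < p.L) {s : ℝ} {q : ℂ[X]} (hq : (q.natDegree : ℝ) < s) {f : ℝ → ℂ}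
    (hf : Set.EqOn f (p.wave s q) (Set.Ioo 0 p.L)) : p.InL2 f := by
  have hae : p.wave s q =ᵐ[volume.restrict (Set.Icc 0 p.L)] f := by
    rw [← Measure.restrict_congr_set Ioo_ae_eq_Icc]
    exact ae_restrict_of_forall_mem measurableSet_Ioo fun x hx => (hf hx).symm
  have hcont := continuousOn_wave hL hq
  obtain ⟨M, hM⟩ := isCompact_Icc.exists_bound_of_continuousOn hcont
  exact (MemLp.of_bound (hcont.aestronglyMeasurable measurableSet_Icc) M
    (ae_restrict_of_forall_mem measurableSet_Icc hM)).ae_eq hae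

theorem meanValue_of_eqOn (hL : 0 ≤ p.L) {s : ℝ} {f g : ℂ[X]} {ψ : ℝ → ℂ} {T : (ℝ → ℂ) → ℝ → ℂ}
    (hψ : Set.EqOn ψ (p.wave s f) (Set.Ioo 0 p.L))
    (hT : Set.EqOn (T ψ) (p.wave s g) (Set.Ioo 0 p.L)) :
    p.meanValue T ψ = p.waveInner s f g := by
  simp only [meanValue, waveInner, intervalIntegral.integral_of_le hL,
    integral_Ioc_eq_integral_Ioo]
  exact setIntegral_congr_fun measurableSet_Ioo fun x hx => by simp only [hψ hx, hT hx]

theorem inL2_and_meanValue_of_eqOn_smul (hL : 0 < p.L) {s : ℝ} {q : ℂ[X]}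
    (hq : (q.natDegree : ℝ) < s) (hnorm : p.waveInner s q q = 1) {c : ℂ} {ψ : ℝ → ℂ}
    {T : (ℝ → ℂ) → ℝ → ℂ} (hψ : Set.EqOn ψ (p.wave s q) (Set.Ioo 0 p.L))
    (hT : Set.EqOn (T ψ) (p.wave s (c • q)) (Set.Ioo 0 p.L)) :
    p.InL2 ψ ∧ p.InL2 (T ψ) ∧ p.meanValue T ψ = c :=
  ⟨inL2_of_eqOn hL hq hψ,
    inL2_of_eqOn hL ((Nat.cast_le.mpr (natDegree_smul_le _ _)).trans_lt hq) hT,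
    by rw [meanValue_of_eqOn hL.le hψ hT, waveInner_smul_right, hnorm, mul_one]⟩

theorem scale_pow_mul_calM_sq (hnu : -1 < p.nu) (hscale : p.scale ≠ 0) {N m : ℕ} {z : ℤ}
    (hz : z + m + 1 = N) :
    (p.scale ^ (m + 1) * p.calM z m) ^ 2 =
      ∏ k ∈ Finset.range (m + 1), p.gap (p.level N) (p.level k) := by
  have hN : (N : ℝ) = z + m + 1 := mod_cast hz.symm
  have hgap (k : ℕ) : p.gap (p.level N) (p.level k) = p.scale ^ 2 *
      (((z : ℝ) + m - k + 1) * ((z : ℝ) + m + 2 * p.nu + k + 3) *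
        (1 + p.beta ^ 2 / (((k : ℝ) + p.nu + 1) * ((z : ℝ) + m + p.nu + 2)) ^ 2)) := by
    rw [show (z : ℝ) + m + p.nu + 2 = p.level N by rw [level, hN]; ring, gap, level, level, hN]
    ring
  have hnonneg := prod_gap_nonneg hnu hscale N (m + 1)
  simp only [hgap, Finset.prod_mul_distrib (f := fun _ => p.scale ^ 2), Finset.prod_const,
    Finset.card_range] at hnonneg ⊢
  rw [mul_pow, calM, Real.sq_sqrt, pow_right_comm]
  exact nonneg_of_mul_nonneg_right hnonneg (by positivity)

theorem opB_opBdag_eigenfunction_eqOn (hhbar : p.hbar ≠ 0) (hmass : p.mass ≠ 0) (hL : 0 < p.L)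
    (hnu : -1 < p.nu) (m n : ℕ) :
    Set.EqOn (p.opB m (p.opBdag m (p.eigenfunction (m + 1) n)))
      (p.wave (p.level (n + (m + 1))) ((∏ k ∈ Finset.range (m + 1),
        (p.gap (p.level (n + (m + 1))) (p.level k) : ℂ)) • p.eigenPoly (m + 1) n))
      (Set.Ioo 0 p.L) := by
  have heigen := opB_eqOn hhbar hmass hL hnu m (opBdag_eqOn hhbar hmass hL hnu m
    (eigenfunction_eqOn hhbar hmass hL hnu (m + 1) n))
  have hchain := (isRomanovski_phiPoly (p := p) (n + (m + 1))).factorizationChain hnu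
  rwa [eigenPoly, map_smul, hchain.raiseChain_lowerChain, map_smul, map_smul, smul_comm] at heigen

theorem opBdag_opB_phi_eqOn (hhbar : p.hbar ≠ 0) (hmass : p.mass ≠ 0) (hL : 0 < p.L)
    (hnu : -1 < p.nu) (m n : ℕ) :
    Set.EqOn (p.opBdag m (p.opB m (p.phi n)))
      (p.wave (p.level n) ((∏ k ∈ Finset.range (m + 1),
        (p.gap (p.level n) (p.level k) : ℂ)) • p.phiPoly n)) (Set.Ioo 0 p.L) := by
  have hphi := opBdag_eqOn hhbar hmass hL hnu m (opB_eqOn hhbar hmass hL hnu m (phi_eqOn n))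
  rwa [((isRomanovski_phiPoly n).factorizationChain hnu).raiseChain_lowerChain] at hphi

end Hierarchy

end PTParams

open PTParams in
theorem proposition5_general (p : PTParams) (hhbar : p.hbar ≠ 0) (hmass : p.mass ≠ 0)
    (hL : 0 < p.L) (hnu : -1 < p.nu) (m n : ℕ) :
    (∀ k ≤ m, ∀ x ∈ Set.Ioo (0 : ℝ) p.L, p.eigenfunction k 0 x ≠ 0) ∧
    (∀ k ≤ m + 1, ∀ j : ℕ, ContDiffOn ℝ ∞ (p.eigenfunction k j) (Set.Ioo (0 : ℝ) p.L)) ∧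
    (p.InL2 (p.eigenfunction (m + 1) n) ∧
      p.InL2 (p.opB m (p.opBdag m (p.eigenfunction (m + 1) n))) ∧
      p.meanValue (fun f => p.opB m (p.opBdag m f)) (p.eigenfunction (m + 1) n) =
        ((((Real.pi * p.hbar / p.L) ^ (m + 1) * p.calM (n : ℤ) m) ^ 2 : ℝ) : ℂ)) ∧
    (p.InL2 (p.phi n) ∧
      p.InL2 (p.opBdag m (p.opB m (p.phi n))) ∧
      p.meanValue (fun f => p.opBdag m (p.opB m f)) (p.phi n) =
        ((((Real.pi * p.hbar / p.L) ^ (m + 1) * p.calM ((n : ℤ) - m - 1) m) ^ 2 : ℝ) : ℂ)) := by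
  have hscale := scale_ne_zero hhbar hL.ne'
  have hB := scale_pow_mul_calM_sq hnu hscale (N := n + (m + 1)) (m := m) (z := n)
    (by push_cast; ring)
  have hBdag := scale_pow_mul_calM_sq hnu hscale (N := n) (m := m) (z := n - m - 1) (by ring)
  rw [← scale, hB, hBdag, Complex.ofReal_prod, Complex.ofReal_prod]
  refine ⟨fun k _ x hx => eigenfunction_zero_ne_zero hhbar hmass hL hnu k hx, fun k _ j => ?_,
    ?_, ?_⟩
  · exact (contDiffOn_wave _ _).congr (eigenfunction_eqOn hhbar hmass hL hnu k j)
  · exact inL2_and_meanValue_of_eqOn_smul (T := fun f => p.opB m (p.opBdag m f)) hL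
      (natDegree_eigenPoly_lt hnu hscale (m + 1) n)
      (waveInner_eigenPoly hL hnu hscale (m + 1) n)
      (eigenfunction_eqOn hhbar hmass hL hnu (m + 1) n)
      (opB_opBdag_eigenfunction_eqOn hhbar hmass hL hnu m n)
  · exact inL2_and_meanValue_of_eqOn_smul (T := fun f => p.opBdag m (p.opB m f)) hL
      ((isRomanovski_phiPoly n).natDegree_lowerChain_lt hnu hscale 0)
      (waveInner_phiPoly hL hnu hscale n) (phi_eqOn n)
      (opBdag_opB_phi_eqOn hhbar hmass hL hnu m n)

theorem proposition5 (p : PTParams) (hhbar : 0 < p.hbar) (hmass : 0 < p.mass) (hL : 0 < p.L)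
    (hnu : 0 ≤ p.nu) (hbeta : 0 ≤ p.beta) (m n : ℕ) :
    -- the superpotentials and all derivatives that occur exist on the open interval
    (∀ k ≤ m, ∀ x ∈ Set.Ioo (0 : ℝ) p.L, p.eigenfunction k 0 x ≠ 0) ∧
    (∀ k ≤ m + 1, ∀ j : ℕ, ContDiffOn ℝ ∞ (p.eigenfunction k j) (Set.Ioo (0 : ℝ) p.L)) ∧
    -- the mean value of `B_m B_m†` in the state `φ_n^{(m+1)}`
    (p.InL2 (p.eigenfunction (m + 1) n) ∧
      p.InL2 (p.opB m (p.opBdag m (p.eigenfunction (m + 1) n))) ∧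
      p.meanValue (fun f => p.opB m (p.opBdag m f)) (p.eigenfunction (m + 1) n) =
        ((((Real.pi * p.hbar / p.L) ^ (m + 1) * p.calM (n : ℤ) m) ^ 2 : ℝ) : ℂ)) ∧
    -- the mean value of `B_m† B_m` in the state `φ_n`
    (p.InL2 (p.phi n) ∧
      p.InL2 (p.opBdag m (p.opB m (p.phi n))) ∧
      p.meanValue (fun f => p.opBdag m (p.opB m f)) (p.phi n) =
        ((((Real.pi * p.hbar / p.L) ^ (m + 1) * p.calM ((n : ℤ) - m - 1) m) ^ 2 : ℝ) : ℂ)) :=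
  proposition5_general p hhbar.ne' hmass.ne' hL (by linarith) m n
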